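/- Let $0\le k\le n$ and let $\mathcal F$ be the complex vector space of functions on the set $X$ of $k$-subsets of $\{1,\dots,n\}$, with the action $\sigma f=f\circ\sigma^{-1}$ of $S_n$. For $0\le j\le n$ let $S_j\subseteq S_n$ be the subgroup of permutations fixing $j+1,\dots,n$, and for an irreducible complex representation $\lambda$ of $S_j$ let $\mathcal F_{j,\lambda}$ be the $\lambda$-isotypic component of $\mathcal F$ as an $S_j$-module. Write $\mu\nearrow\lambda$, for irreducible representations $\mu$ of $S_j$ and $\lambda$ of $S_{j+1}$, if $\dim\operatorname{Hom}_{S_j}(\mu,\lambda)=1$. Identify a $k$-subset $x$ with the word $w_1\cdots w_n$ in the alphabet $\{1,2\}$ such that $w_m=1$ if and only if $m\in x$, and let $\mathcal F^{m,c}$ be the span of the delta functions of those words in $X$ that have the letter $c$ at place $m$. For $0\le i\le n$, for a chain $\lambda_1\nearrow\lambda_2\nearrow\cdots\nearrow\lambda_i$ of irreducible representations $\lambda_j$ of $S_j$, and for a word $c_{i+1}\cdots c_n$ in the alphabet $\{1,2\}$ in which the letter $1$ occurs at most $k$ times, put $$\mathcal F^{c_{i+1}\cdots c_n}_{\lambda_1\cdots\lambda_i}=\bigcap_{j=1}^{i}\mathcal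 F_{j,\lambda_j}\ \cap\bigcap_{m=i+1}^{n}\mathcal F^{m,c_m},$$ an empty intersection being $\mathcal F$. An $i$-th intermediate basis is a basis $B_i$ of $\mathcal F$ each of whose elements lies in one of the subspaces $\mathcal F^{c_{i+1}\cdots c_n}_{\lambda_1\cdots\lambda_i}$ (so $B_0$ consists of multiples of delta functions, and $B_n$ is a Gelfand-Tsetlin basis). **Theorem.** Let $1\le i\le n$, let $B_i$ be an $i$-th and $B_{i-1}$ an $(i-1)$-th intermediate basis of $\mathcal F$, and let $[B_i]_{B_{i-1}}$ be the change of basis matrix, whose columns are the elements of $B_i$ written in the basis $B_{i-1}$. Then there are an order of $B_i$ and an order of $B_{i-1}$ for which $[B_i]_{B_{i-1}}$ is block-diagonal with all (square) blocks of size at most two. In particular, each column of $[B_i]_{B_{i-1}}$ has at most two nonzero entries. -/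

import Mathlib

open scoped MonoidAlgebra

noncomputable section

namespace Johnson

/-- The `k`-subsets of an `n`-element set. The element `m : Fin n` stands for the place
`m + 1` of `{1, …, n}`. -/
abbrev KSet (n k : ℕ) : Type := {x : Finset (Fin n) // x.card = k}

/-- The space of complex valued functions on the set of `k`-sets. -/
abbrev FunSpace (n k : ℕ) : Type := KSet n k → ℂ

/-- The action of a permutation on a `k`-set, `{i₁, …, iₖ} ↦ {σ i₁, …, σ iₖ}`. -/
def permKSet {n k : ℕ} (σ : Equiv.Perm (Fin n)) (x : KSet n k) : KSet n k :=
  ⟨x.1.map σ.toEmbedding, by rw [Finset.card_map]; exact x.2⟩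

/-- The representation of the symmetric group on functions, `σ f = f ∘ σ⁻¹`. -/
def funRep (n k : ℕ) : Representation ℂ (Equiv.Perm (Fin n)) (FunSpace n k) where
  toFun σ :=
    { toFun := fun f x => f (permKSet σ⁻¹ x)
      map_add' := fun _ _ => rfl
      map_smul' := fun _ _ => rfl }
  map_one' := by
    refine LinearMap.ext fun f => funext fun x => congrArg f (Subtype.ext ?_)
    ext m
    simp only [permKSet, Finset.mem_map_equiv]
    exact Iff.rfl
  map_mul' σ τ := by
    refine LinearMap.ext fun f => funext fun x => congrArg f (Subtype.ext ?_)
    ext m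
    simp only [permKSet, Finset.mem_map_equiv]
    exact Iff.rfl

/-- The subgroup `S_j` of the permutations that fix the last `n - j` places. -/
def initialSym (n j : ℕ) : Subgroup (Equiv.Perm (Fin n)) where
  carrier := {σ | ∀ m : Fin n, j ≤ m.val → σ m = m}
  one_mem' := fun _ _ => rfl
  mul_mem' := by
    intro σ τ hσ hτ m hm
    rw [Equiv.Perm.mul_apply, hτ m hm, hσ m hm]
  inv_mem' := by
    intro σ hσ m hm
    rw [Equiv.Perm.inv_eq_iff_eq]
    exact (hσ m hm).symm

theorem initialSym_mono (n : ℕ) {i j : ℕ} (h : i ≤ j) : initialSym n i ≤ initialSym n j :=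
  fun _ hσ m hm => hσ m (h.trans hm)

/-- An irreducible complex representation of `G` on some `ℂ^d`; for a finite group every
irreducible complex representation is isomorphic to one of these. -/
structure Irrep (G : Type) [Group G] where
  dim : ℕ
  rep : Representation ℂ G (Fin dim → ℂ)
  irreducible : rep.IsIrreducible

/-- The edges `μ ↗ l` of the branching graph, for an irreducible `μ` of `S_i` and an irreducible
`l` of `S_j`, where `i ≤ j` (it is used for `j = i + 1`): the space of `S_i`-equivariant maps
from `μ` to the restriction of `l` is one-dimensional. -/
def Branches {n i j : ℕ} (h : i ≤ j) (μ : Irrep (initialSym n i)) (l : Irrep (initialSym n j)) :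
    Prop :=
  Module.finrank ℂ (Representation.IntertwiningMap μ.rep
    (l.rep.comp (Subgroup.inclusion (initialSym_mono n h)))) = 1

/-- The function space as a representation of the subgroup `S_j`. -/
def funRepRestrict (n k j : ℕ) : Representation ℂ (initialSym n j) (FunSpace n k) :=
  (funRep n k).comp (initialSym n j).subtype

/-- The isotypic component `F_{j,l}` of the function space, as an `S_j`-module, for the
irreducible representation `l` of `S_j`. -/
def isotypic {n j : ℕ} (k : ℕ) (l : Irrep (initialSym n j)) : Submodule ℂ (FunSpace n k) :=
  (Subrepresentation.ofSubmodule' (isotypicComponent ℂ[initialSym n j]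
    (funRepRestrict n k j).asModule l.rep.asModule)).toSubmodule

/-- A chain `l₁ ↗ l₂ ↗ ⋯ ↗ l_i` in the branching graph; `irr j` is `l_{j+1}`. -/
structure BranchChain (n i : ℕ) where
  irr : ∀ j : Fin i, Irrep (initialSym n (j.val + 1))
  branches : ∀ (j : ℕ) (h : j + 1 < i),
    Branches (Nat.le_succ (j + 1)) (irr ⟨j, Nat.lt_of_succ_lt h⟩) (irr ⟨j + 1, h⟩)

/-- The alphabet `{1, 2}`. -/
inductive Letter : Type
  | one
  | two

/-- The letter at place `m` of the word of a `k`-set: `1` if `m` belongs to it, else `2`. -/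
def letterAt {n k : ℕ} (x : KSet n k) (m : Fin n) : Letter :=
  if m ∈ x.1 then Letter.one else Letter.two

/-- The delta function of a `k`-set. -/
def delta {n k : ℕ} (x : KSet n k) : FunSpace n k := Pi.single x 1

/-- The span `F^{m,c}` of the delta functions of the words with the letter `c` at place `m`. -/
def letterSpace {n : ℕ} (k : ℕ) (m : Fin n) (c : Letter) : Submodule ℂ (FunSpace n k) :=
  Submodule.span ℂ {f | ∃ x : KSet n k, letterAt x m = c ∧ f = delta x}

/-- A word `c_{i+1} … c_n`: a letter at each of the last `n - i` places. -/
abbrev TailWord (n i : ℕ) : Type := {m : Fin n // i ≤ m.val} → Letter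

/-- The letter `1` occurs at most `k` times in the word. -/
def TailWord.Admissible {n i : ℕ} (k : ℕ) (c : TailWord n i) : Prop :=
  Nat.card {m // c m = Letter.one} ≤ k

/-- The subspace `F^{c_{i+1} … c_n}`, the intersection of the `F^{m,c_m}`. -/
def tailSpace {n i : ℕ} (k : ℕ) (c : TailWord n i) : Submodule ℂ (FunSpace n k) :=
  ⨅ m : {m : Fin n // i ≤ m.val}, letterSpace k m.1 (c m)

/-- The subspace `F_{l₁ … l_i}^{c_{i+1} … c_n}`: the intersection of the isotypic components of
the `l_j` under `S_j`, for `j = 1, …, i`, and of `F^{c_{i+1} … c_n}`. -/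
def gtSpace {n i : ℕ} (k : ℕ) (l : BranchChain n i) (c : TailWord n i) :
    Submodule ℂ (FunSpace n k) :=
  (⨅ j : Fin i, isotypic k (l.irr j)) ⊓ tailSpace k c

/-- `B` is an `i`-th intermediate basis: a basis of the function space adapted to its
decomposition into the subspaces `F_{l₁ … l_i}^{c_{i+1} … c_n}`, that is, each of its elements
lies in one of them. -/
def IsIntermediateBasis {n k : ℕ} (i : ℕ) {ι : Type*} (B : Module.Basis ι ℂ (FunSpace n k)) :
    Prop :=
  ∀ a : ι, ∃ (l : BranchChain n i) (c : TailWord n i), c.Admissible k ∧ B a ∈ gtSpace k l c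

/-- The change of basis matrix `[B]_{B'}`, whose columns are the elements of `B` written in the
basis `B'`. -/
def changeOfBasis {n k : ℕ} {ι ι' : Type*} (B : Module.Basis ι ℂ (FunSpace n k))
    (B' : Module.Basis ι' ℂ (FunSpace n k)) : Matrix ι' ι ℂ :=
  B'.toMatrix B

/-- The square matrix `M` is block-diagonal, the sizes of its consecutive diagonal blocks being
the parts of the composition `s` of `N`. -/
def IsBlockDiagonal {N : ℕ} (s : Composition N) (M : Matrix (Fin N) (Fin N) ℂ) : Prop :=
  ∀ a b : Fin N, s.index a ≠ s.index b → M a b = 0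

end Johnson

end

/-! Drop the condition at place `i`. Both bases are adapted to the resulting subspaces W =
F_{λ₁…λ_{i-1}}^{c_{i+1}…c_n} (`partialSpace`). The isotypic components for one S_j are independent,
and so are the two letter spaces at one place; hence an element of B_i lying in W involves only
elements of B_{i-1} with the same W (`partialSpace_eq_of_repr_ne_zero`). Each basis has exactly dim
W elements labelled by W (`card_fiber_eq_finrank`), so the blocks are square. The elements of
B_{i-1} in W are sorted by their letter at place `i`, so a block has size at most two once every
F_{λ₁…λ_{i-1}}^{c_i…c_n} is at most a line (`exists_gtSpace_le_span`).

That bound rests on two multiplicity-one facts. Any two words with the same tail are exchanged by a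
single element of S_i, so equivariant endomorphisms of F^{c_{i+1}…c_n} have symmetric matrices and
therefore commute (Gelfand's trick). Thus λ_i occurs there at most once. Each edge of the branching
graph then singles out at most one copy of λ_j inside the copy of λ_{j+1}, down to the trivial group
S_1, whose irreducibles are lines. -/

namespace Representation

/-! ### Schur's lemma, Maschke's theorem and multiplicity one -/

section General

variable {G V S W : Type*} [Group G] [AddCommGroup V] [Module ℂ V] [AddCommGroup S] [Module ℂ S]
  [AddCommGroup W] [Module ℂ W]

/-- An equivariant map sends an isotypic component into the image of `θ` if `θ` spans the space of
the equivariant maps from the corresponding representation to the target. -/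
theorem IntertwiningMap.apply_mem_range_of_mem_isotypicComponent {ρ : Representation ℂ G V}
    {τ : Representation ℂ G S} {σ : Representation ℂ G W} (R : IntertwiningMap ρ σ)
    (θ : IntertwiningMap τ σ) (hθ : ∀ φ : IntertwiningMap τ ρ, ∃ c : ℂ, R.comp φ = c • θ) {f : V}
    (hf : f ∈ (Subrepresentation.ofSubmodule'
      (isotypicComponent ℂ[G] ρ.asModule τ.asModule)).toSubmodule) :
    ∃ v, θ v = R f := by
  -- The isotypic component is the sum of the submodules isomorphic to `τ`, so it suffices that `R`
  -- carries each of them into the image of `θ`.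
  have key : isotypicComponent ℂ[G] ρ.asModule τ.asModule ≤
      (Subrepresentation.asSubmodule θ.range).comap
        (equivLinearMapAsModule ρ σ R) := by
    refine sSup_le ?_
    rintro N ⟨e⟩ x hx
    obtain ⟨c, hc⟩ := hθ ((equivLinearMapAsModule τ ρ).symm (N.subtype ∘ₗ e.symm.toLinearMap))
    let u : S := τ.asModuleEquiv (e ⟨x, hx⟩)
    have hu : R (ρ.asModuleEquiv (N.subtype (e.symm (e ⟨x, hx⟩)))) = (c • θ) u :=
      congrArg (fun φ : IntertwiningMap τ σ => φ u) hc
    rw [LinearEquiv.symm_apply_apply] at hu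
    exact ⟨c • u, (map_smul θ c u).trans hu.symm⟩
  exact key hf

/-- Maschke's theorem: an injective equivariant map has an equivariant retraction. -/
theorem IntertwiningMap.exists_retraction [Finite G] {ρ : Representation ℂ G V}
    {τ : Representation ℂ G S} (φ : IntertwiningMap τ ρ) (hφ : Function.Injective φ) :
    ∃ R : IntertwiningMap ρ τ, ∀ v, R (φ v) = v := by
  have : NeZero (Nat.card G : ℂ) := ⟨Nat.cast_ne_zero.mpr Nat.card_pos.ne'⟩
  obtain ⟨g, hg⟩ := MonoidAlgebra.exists_leftInverse_of_injective
    (equivLinearMapAsModule τ ρ φ) (LinearMap.ker_eq_bot.mpr hφ)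
  exact ⟨(equivLinearMapAsModule ρ τ).symm g, fun v => congrArg (fun t => t v) hg⟩

/-- Schur's lemma. -/
theorem IntertwiningMap.exists_eq_smul_id [FiniteDimensional ℂ S] {τ : Representation ℂ G S}
    [τ.IsIrreducible] (φ : IntertwiningMap τ τ) : ∃ c : ℂ, ∀ v, φ v = c • v := by
  obtain ⟨c, hc⟩ := (IsIrreducible.algebraMap_intertwiningMap_bijective_of_isAlgClosed (ρ := τ)).2 φ
  refine ⟨c, fun v => ?_⟩
  rw [← hc, Algebra.algebraMap_eq_smul_one]
  rfl

/-- If the equivariant endomorphisms of the image of the equivariant projection `P` commute, each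
irreducible representation has multiplicity at most one in that image. -/
theorem IntertwiningMap.exists_forall_comp_eq_smul [Finite G] [FiniteDimensional ℂ S]
    {ρ : Representation ℂ G V} {τ : Representation ℂ G S} [τ.IsIrreducible]
    (P : IntertwiningMap ρ ρ) (hP : ∀ v, P (P v) = P v)
    (hcomm : ∀ A B : IntertwiningMap ρ ρ, ∀ v, P (A (P (B (P v)))) = P (B (P (A (P v))))) :
    ∃ θ : IntertwiningMap τ ρ, ∀ φ : IntertwiningMap τ ρ, ∃ c : ℂ, P.comp φ = c • θ := by
  by_cases h0 : ∀ φ : IntertwiningMap τ ρ, P.comp φ = 0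
  · exact ⟨0, fun φ => ⟨0, by rw [h0, zero_smul]⟩⟩
  push Not at h0
  obtain ⟨φ₀, h₀⟩ := h0
  obtain ⟨R, hR⟩ := (P.comp φ₀).exists_retraction
    ((IsIrreducible.injective_or_eq_zero (P.comp φ₀)).resolve_right h₀)
  refine ⟨P.comp φ₀, fun φ => ?_⟩
  obtain ⟨c, hc⟩ := IntertwiningMap.exists_eq_smul_id (R.comp (P.comp φ))
  refine ⟨c, IntertwiningMap.ext (LinearMap.ext fun v => ?_)⟩
  -- Write θ = Pφ₀. The endomorphisms θR and PφR, applied to θv in the two orders, give θ(RPφv) =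
  -- cθv and Pφv.
  have h := hcomm ((P.comp φ₀).comp R) ((P.comp φ).comp R) (φ₀ v)
  simp only [IntertwiningMap.comp_apply, hP] at h hR hc
  rw [hR, hc, map_smul, map_smul, hR] at h
  exact h.symm

end General

end Representation

/-! ### Descent along the branching graph -/

namespace Johnson

open Representation

theorem exists_intertwiningMap_branches {n i j : ℕ} {h : i ≤ j} {μ : Irrep (initialSym n i)}
    {l : Irrep (initialSym n j)} (hb : Branches h μ l) :
    ∃ θ : IntertwiningMap μ.rep (l.rep.comp (Subgroup.inclusion (initialSym_mono n h))),
      ∀ φ : IntertwiningMap μ.rep (l.rep.comp (Subgroup.inclusion (initialSym_mono n h))),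
        ∃ c : ℂ, φ = c • θ := by
  obtain ⟨θ, -, hθ⟩ := finrank_eq_one_iff'.mp hb
  exact ⟨θ, fun φ => (hθ φ).imp fun _ h => h.symm⟩

/-- The descent along an edge of the branching graph. -/
theorem exists_range_of_branches {n k j : ℕ} {μ : Irrep (initialSym n j)}
    {l : Irrep (initialSym n (j + 1))} (hb : Branches (Nat.le_succ j) μ l)
    (ψ : IntertwiningMap l.rep (funRepRestrict n k (j + 1))) :
    ∃ ψ' : IntertwiningMap μ.rep (funRepRestrict n k j),
      ∀ f ∈ isotypic k μ, (∃ v, ψ v = f) → ∃ v, ψ' v = f := by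
  have := l.irreducible
  obtain ⟨θ, hθ⟩ := exists_intertwiningMap_branches hb
  rcases IsIrreducible.injective_or_eq_zero ψ with hψ | hψ
  · obtain ⟨R, hR⟩ := ψ.exists_retraction hψ
    let R' : IntertwiningMap (funRepRestrict n k j)
        (l.rep.comp (Subgroup.inclusion (initialSym_mono n (Nat.le_succ j)))) :=
      ⟨R.toLinearMap, fun g => R.isIntertwining' (Subgroup.inclusion (initialSym_mono n (Nat.le_succ j)) g)⟩
    let ψ₁ : IntertwiningMap (l.rep.comp (Subgroup.inclusion (initialSym_mono n (Nat.le_succ j))))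
        (funRepRestrict n k j) :=
      ⟨ψ.toLinearMap, fun g => ψ.isIntertwining' (Subgroup.inclusion (initialSym_mono n (Nat.le_succ j)) g)⟩
    refine ⟨ψ₁.comp θ, ?_⟩
    rintro f hf ⟨v, rfl⟩
    -- `R'` sends f = ψv to v, and f is in the component of `μ`. As `μ` occurs once in the
    -- restriction of `l`, v lies in the image of `θ`.
    obtain ⟨u, hu⟩ := R'.apply_mem_range_of_mem_isotypicComponent θ (fun φ => hθ _) hf
    refine ⟨u, ?_⟩
    rw [IntertwiningMap.comp_apply, hu]
    change ψ (R (ψ v)) = ψ v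
    rw [hR]
  · refine ⟨0, ?_⟩
    rintro f - ⟨v, rfl⟩
    exact ⟨0, by rw [hψ]; rfl⟩

end Johnson

/-! ### Words with a given tail and Gelfand's trick -/

namespace Johnson

open Representation

theorem mem_permKSet {n k : ℕ} (σ : Equiv.Perm (Fin n)) (x : KSet n k) (m : Fin n) :
    m ∈ (permKSet σ x).1 ↔ σ⁻¹ m ∈ x.1 := by
  simp only [permKSet, Finset.mem_map_equiv]
  exact Iff.rfl

theorem permKSet_inv_permKSet {n k : ℕ} (σ : Equiv.Perm (Fin n)) (x : KSet n k) :
    permKSet σ⁻¹ (permKSet σ x) = x := by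
  refine Subtype.ext (Finset.ext fun m => ?_)
  simp [mem_permKSet]

theorem letterAt_eq_letterAt_iff {n k : ℕ} (x y : KSet n k) (m m' : Fin n) :
    letterAt x m = letterAt y m' ↔ (m ∈ x.1 ↔ m' ∈ y.1) := by
  unfold letterAt
  split_ifs <;> simp_all

/-- The word of the `k`-set `x` ends with `c`. -/
def HasTail {n k i : ℕ} (c : TailWord n i) (x : KSet n k) : Prop :=
  ∀ m : {m : Fin n // i ≤ m.val}, letterAt x m.1 = c m

theorem hasTail_permKSet {n k i : ℕ} (c : TailWord n i) {σ : Equiv.Perm (Fin n)}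
    (hσ : σ ∈ initialSym n i) (x : KSet n k) : HasTail c (permKSet σ x) ↔ HasTail c x := by
  refine forall_congr' fun m => ?_
  have h : letterAt (permKSet σ x) m.1 = letterAt x m.1 := by
    rw [letterAt_eq_letterAt_iff, mem_permKSet, (initialSym n i).inv_mem hσ m.1 m.2]
  rw [h]

/-- Two `k`-sets with the same last letters are exchanged by an element of `S_i`. -/
theorem exists_mem_initialSym_swap {n k i : ℕ} {c : TailWord n i} {x y : KSet n k}
    (hx : HasTail c x) (hy : HasTail c y) :
    ∃ σ ∈ initialSym n i, permKSet σ x = y ∧ permKSet σ y = x := by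
  classical
  have hcard : (x.1 \ y.1).card = (y.1 \ x.1).card :=
    Finset.card_sdiff_comm (x.2.trans y.2.symm)
  -- The involution swaps x \ y with y \ x along a bijection and fixes all else; the last places are
  -- fixed because the tails agree there.
  let e : ↥(x.1 \ y.1) ≃ ↥(y.1 \ x.1) := Finset.equivOfCardEq hcard
  let f : Fin n → Fin n := fun m =>
    if h : m ∈ x.1 \ y.1 then e ⟨m, h⟩ else if h : m ∈ y.1 \ x.1 then e.symm ⟨m, h⟩ else m
  have hfx : ∀ m (h : m ∈ x.1 \ y.1), f m = e ⟨m, h⟩ := fun m h => dif_pos h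
  have hfy : ∀ m (h : m ∈ y.1 \ x.1), f m = e.symm ⟨m, h⟩ := fun m h => by
    have h' : m ∉ x.1 \ y.1 := by simp only [Finset.mem_sdiff] at h ⊢; tauto
    simp only [f, dif_neg h', dif_pos h]
  have hfo : ∀ m, (m ∈ x.1 ↔ m ∈ y.1) → f m = m := fun m h => by
    have h₁ : m ∉ x.1 \ y.1 := by simp only [Finset.mem_sdiff]; tauto
    have h₂ : m ∉ y.1 \ x.1 := by simp only [Finset.mem_sdiff]; tauto
    simp only [f, dif_neg h₁, dif_neg h₂]
  have hcases : ∀ m, m ∈ x.1 \ y.1 ∨ m ∈ y.1 \ x.1 ∨ (m ∈ x.1 ↔ m ∈ y.1) := fun m => by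
    simp only [Finset.mem_sdiff]; tauto
  have hmem : ∀ m, (f m ∈ x.1 ↔ m ∈ y.1) ∧ (f m ∈ y.1 ↔ m ∈ x.1) := by
    intro m
    rcases hcases m with h | h | h
    · rw [hfx m h]
      have := (e ⟨m, h⟩).2
      simp only [Finset.mem_sdiff] at h this
      tauto
    · rw [hfy m h]
      have := (e.symm ⟨m, h⟩).2
      simp only [Finset.mem_sdiff] at h this
      tauto
    · rw [hfo m h]
      tauto
  have hf : Function.Involutive f := by
    intro m
    rcases hcases m with h | h | h
    · rw [hfx m h, hfy _ (e ⟨m, h⟩).2]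
      simp
    · rw [hfy m h, hfx _ (e.symm ⟨m, h⟩).2]
      simp
    · rw [hfo m h, hfo m h]
  refine ⟨hf.toPerm, ?_, ?_, ?_⟩
  · intro m hm
    refine hfo m ?_
    rw [← letterAt_eq_letterAt_iff, hx ⟨m, hm⟩, hy ⟨m, hm⟩]
  · refine Subtype.ext (Finset.ext fun m => ?_)
    rw [mem_permKSet]
    exact (hmem m).1
  · refine Subtype.ext (Finset.ext fun m => ?_)
    rw [mem_permKSet]
    exact (hmem m).2

open Classical in
/-- The projection onto the functions supported on the words that end with `c`. -/
noncomputable def tailProjection {n i : ℕ} (k : ℕ) (c : TailWord n i) :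
    IntertwiningMap (funRepRestrict n k i) (funRepRestrict n k i) where
  toFun f x := if HasTail c x then f x else 0
  map_add' f g := by ext x; simp only [Pi.add_apply]; split_ifs <;> simp
  map_smul' a f := by ext x; simp
  isIntertwining' g := by
    refine LinearMap.ext fun f => funext fun x => ?_
    change (if HasTail c x then f (permKSet g.1⁻¹ x) else 0) =
      if HasTail c (permKSet g.1⁻¹ x) then f (permKSet g.1⁻¹ x) else 0
    simp only [hasTail_permKSet c ((initialSym n i).inv_mem g.2)]

open Classical in
theorem tailProjection_apply {n k i : ℕ} (c : TailWord n i) (f : FunSpace n k) (x : KSet n k) :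
    tailProjection k c f x = if HasTail c x then f x else 0 := rfl

theorem tailProjection_tailProjection {n k i : ℕ} (c : TailWord n i) (f : FunSpace n k) :
    tailProjection k c (tailProjection k c f) = tailProjection k c f := by
  ext x
  simp only [tailProjection_apply]
  split_ifs <;> rfl

theorem apply_eq_zero_of_mem_letterSpace {n k : ℕ} {m : Fin n} {c : Letter} {f : FunSpace n k}
    (hf : f ∈ letterSpace k m c) {x : KSet n k} (hx : letterAt x m ≠ c) : f x = 0 := by
  induction hf using Submodule.span_induction with
  | mem g hg =>
    obtain ⟨y, hy, rfl⟩ := hg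
    exact Pi.single_eq_of_ne (by rintro rfl; exact hx hy) _
  | zero => rfl
  | add g g' _ _ h h' => rw [Pi.add_apply, h, h', add_zero]
  | smul a g _ h => rw [Pi.smul_apply, h, smul_zero]

theorem tailProjection_of_mem_tailSpace {n k i : ℕ} {c : TailWord n i} {f : FunSpace n k}
    (hf : f ∈ tailSpace k c) : tailProjection k c f = f := by
  ext x
  rw [tailProjection_apply]
  split_ifs with h
  · rfl
  · unfold HasTail at h
    push Not at h
    obtain ⟨m, hm⟩ := h
    exact (apply_eq_zero_of_mem_letterSpace (Submodule.mem_iInf _ |>.mp hf m) hm).symm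

theorem funRep_apply_permKSet {n k : ℕ} (σ : Equiv.Perm (Fin n)) (f : FunSpace n k)
    (x : KSet n k) : funRep n k σ f (permKSet σ x) = f x :=
  congrArg f (permKSet_inv_permKSet σ x)

theorem funRep_delta {n k : ℕ} (σ : Equiv.Perm (Fin n)) (x : KSet n k) :
    funRep n k σ (delta x) = delta (permKSet σ x) := by
  ext y
  change delta x (permKSet σ⁻¹ y) = _
  by_cases h : y = permKSet σ x
  · rw [h, permKSet_inv_permKSet, delta, delta, Pi.single_eq_same, Pi.single_eq_same]
  · rw [delta, delta, Pi.single_eq_of_ne h, Pi.single_eq_of_ne]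
    rintro rfl
    refine h ?_
    conv_lhs => rw [← permKSet_inv_permKSet σ⁻¹ y, inv_inv]

/-- The matrix of an equivariant endomorphism of `F^{c_{i+1} … c_n}` is symmetric. -/
theorem tailProjection_comp_symm {n k i : ℕ} (c : TailWord n i)
    (A : IntertwiningMap (funRepRestrict n k i) (funRepRestrict n k i)) :
    (LinearMap.toMatrix' ((tailProjection k c).comp
      (A.comp (tailProjection k c))).toLinearMap).IsSymm := by
  have hentry : ∀ x y, LinearMap.toMatrix' ((tailProjection k c).comp
      (A.comp (tailProjection k c))).toLinearMap x y =
      tailProjection k c (A (tailProjection k c (delta y))) x := fun x y => by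
    rw [LinearMap.toMatrix'_apply]
    rfl
  have hzero : ∀ y : KSet n k, ¬ HasTail c y → tailProjection k c (delta y) = 0 := fun y hy => by
    ext x
    rw [tailProjection_apply]
    split_ifs with h
    · exact Pi.single_eq_of_ne (by rintro rfl; exact hy h) _
    · rfl
  have hone : ∀ y : KSet n k, HasTail c y → tailProjection k c (delta y) = delta y :=
    fun y hy => by
    ext x
    rw [tailProjection_apply]
    split_ifs with h
    · rfl
    · have hne : x ≠ y := by
        rintro rfl
        exact h hy
      rw [delta, Pi.single_eq_of_ne hne]
  ext x y
  rw [Matrix.transpose_apply, hentry, hentry]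
  by_cases hx : HasTail c x
  · by_cases hy : HasTail c y
    · obtain ⟨σ, hσ, hxy, hyx⟩ := exists_mem_initialSym_swap hx hy
      rw [hone x hx, hone y hy, tailProjection_apply, tailProjection_apply, if_pos hx, if_pos hy]
      have h := IntertwiningMap.isIntertwining _ _ A ⟨σ, hσ⟩ (delta x)
      have h' : A (delta y) = funRep n k σ (A (delta x)) := by
        rw [← hxy, ← funRep_delta]
        exact h
      rw [h', ← hyx, funRep_apply_permKSet, hyx]
    · rw [hzero y hy, tailProjection_apply _ _ y, if_neg hy, map_zero, map_zero, Pi.zero_apply]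
  · rw [hzero x hx, tailProjection_apply _ _ x, if_neg hx, map_zero, map_zero, Pi.zero_apply]

/-- PAP and PBP have symmetric matrices, and so does their product, since PAPBP has the same form
with APB in place of A. Transposing the product reverses its factors. -/
theorem tailProjection_comp_comm {n k i : ℕ} (c : TailWord n i)
    (A B : IntertwiningMap (funRepRestrict n k i) (funRepRestrict n k i)) (f : FunSpace n k) :
    tailProjection k c (A (tailProjection k c (B (tailProjection k c f)))) =
      tailProjection k c (B (tailProjection k c (A (tailProjection k c f)))) := by
  set P := tailProjection k c with hPdef
  have hmul : ∀ A B : IntertwiningMap (funRepRestrict n k i) (funRepRestrict n k i),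
      LinearMap.toMatrix' (P.comp ((A.comp (P.comp B)).comp P)).toLinearMap =
        LinearMap.toMatrix' (P.comp (A.comp P)).toLinearMap *
          LinearMap.toMatrix' (P.comp (B.comp P)).toLinearMap := fun A B => by
    rw [← LinearMap.toMatrix'_comp]
    congr 1
    refine LinearMap.ext fun v => ?_
    change P (A (P (B (P v)))) = P (A (P (P (B (P v)))))
    rw [tailProjection_tailProjection]
  have key : LinearMap.toMatrix' (P.comp ((A.comp (P.comp B)).comp P)).toLinearMap =
      LinearMap.toMatrix' (P.comp ((B.comp (P.comp A)).comp P)).toLinearMap := by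
    rw [← (tailProjection_comp_symm c (A.comp (P.comp B))).eq, hmul, Matrix.transpose_mul,
      (tailProjection_comp_symm c A).eq, (tailProjection_comp_symm c B).eq, ← hmul]
  exact congrArg (fun t => t f) (LinearMap.toMatrix'.injective key)

/-- The isotypic component of `F^{c_{i+1} … c_n}` is the image of one copy of the irreducible
representation. -/
theorem exists_range_of_isotypic_inf_tailSpace {n k i : ℕ} (l : Irrep (initialSym n i))
    (c : TailWord n i) :
    ∃ ψ : IntertwiningMap l.rep (funRepRestrict n k i),
      ∀ f ∈ isotypic k l ⊓ tailSpace k c, ∃ v, ψ v = f := by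
  have := l.irreducible
  obtain ⟨θ, hθ⟩ := IntertwiningMap.exists_forall_comp_eq_smul (τ := l.rep)
    (tailProjection k c) (tailProjection_tailProjection c) (tailProjection_comp_comm c)
  refine ⟨θ, fun f hf => ?_⟩
  obtain ⟨v, hv⟩ := (tailProjection k c).apply_mem_range_of_mem_isotypicComponent θ hθ hf.1
  exact ⟨v, hv.trans (tailProjection_of_mem_tailSpace hf.2)⟩

/-! ### One-dimensionality of the Gelfand-Tsetlin spaces -/

theorem exists_tailSpace_zero_le_span {n k : ℕ} (c : TailWord n 0) :
    ∃ v : FunSpace n k, tailSpace k c ≤ Submodule.span ℂ {v} := by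
  by_cases h : ∃ x : KSet n k, HasTail c x
  · obtain ⟨x, hx⟩ := h
    refine ⟨delta x, fun f hf => Submodule.mem_span_singleton.mpr ⟨f x, ?_⟩⟩
    ext y
    by_cases hy : y = x
    · rw [hy, Pi.smul_apply, delta, Pi.single_eq_same, smul_eq_mul, mul_one]
    · rw [Pi.smul_apply, delta, Pi.single_eq_of_ne hy, smul_zero,
        ← tailProjection_of_mem_tailSpace hf, tailProjection_apply, if_neg]
      intro hy'
      refine hy (Subtype.ext (Finset.ext fun m => ?_))
      rw [← letterAt_eq_letterAt_iff, hx ⟨m, Nat.zero_le _⟩, hy' ⟨m, Nat.zero_le _⟩]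
  · refine ⟨0, fun f hf => ?_⟩
    have h0 : f = 0 := by
      ext y
      rw [← tailProjection_of_mem_tailSpace hf, tailProjection_apply,
        if_neg fun hy => h ⟨y, hy⟩, Pi.zero_apply]
    rw [h0]
    exact zero_mem _

theorem finrank_irrep_initialSym_one {n : ℕ} (l : Irrep (initialSym n 1)) :
    Module.finrank ℂ (Fin l.dim → ℂ) = 1 := by
  have := l.irreducible
  have h1 : ∀ g : initialSym n 1, g = 1 := by
    intro g
    refine Subtype.ext (Equiv.ext fun m => ?_)
    by_contra hm
    have hm0 : m.val = 0 := by
      by_contra h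
      exact hm (g.2 m (by omega))
    refine hm (g.1.injective (g.2 (g.1 m) ?_))
    by_contra h
    exact hm (Fin.ext (show (g.1 m).val = m.val by omega))
  have : IsMulCommutative (initialSym n 1) := ⟨⟨fun a b => by rw [h1 a, h1 b]⟩⟩
  exact IsIrreducible.finrank_eq_one_of_isMulCommutative l.rep

/-- The spaces `F_{l₁ … l_i}^{c_{i+1} … c_n}` are at most one-dimensional. -/
theorem exists_gtSpace_le_span {n k i : ℕ} (l : BranchChain n i) (c : TailWord n i) :
    ∃ v : FunSpace n k, gtSpace k l c ≤ Submodule.span ℂ {v} := by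
  cases i with
  | zero =>
    obtain ⟨v, hv⟩ := exists_tailSpace_zero_le_span (k := k) c
    exact ⟨v, inf_le_right.trans hv⟩
  | succ i =>
    have hiso : ∀ f ∈ gtSpace k l c, ∀ j, f ∈ isotypic k (l.irr j) := fun f hf j =>
      (Submodule.mem_iInf _).mp hf.1 j
    -- Induction on the number `d` of edges descended from the top of the chain; index `m` carries
    -- the representation of S_{m+1}, so m = 0 is S_1.
    have hdesc : ∀ d m (h : m + d = i), ∃ ψ : IntertwiningMap (l.irr ⟨m, by omega⟩).rep
        (funRepRestrict n k (m + 1)), ∀ f ∈ gtSpace k l c, ∃ v, ψ v = f := by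
      intro d
      induction d with
      | zero =>
        rintro m rfl
        obtain ⟨ψ, hψ⟩ := exists_range_of_isotypic_inf_tailSpace (k := k)
          (l.irr ⟨m, Nat.lt_succ_self m⟩) c
        exact ⟨ψ, fun f hf => hψ f ⟨hiso f hf _, hf.2⟩⟩
      | succ d ih =>
        intro m h
        obtain ⟨ψ, hψ⟩ := ih (m + 1) (by omega)
        obtain ⟨ψ', hψ'⟩ := exists_range_of_branches (l.branches m (by omega)) ψ
        exact ⟨ψ', fun f hf => hψ' f (hiso f hf _) (hψ f hf)⟩
    obtain ⟨ψ, hψ⟩ := hdesc i 0 (Nat.zero_add i)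
    obtain ⟨v, -, hv⟩ := finrank_eq_one_iff'.mp
      (finrank_irrep_initialSym_one (l.irr ⟨0, Nat.succ_pos i⟩))
    refine ⟨ψ v, fun f hf => ?_⟩
    obtain ⟨w, rfl⟩ := hψ f hf
    obtain ⟨a, rfl⟩ := hv w
    exact Submodule.mem_span_singleton.mpr ⟨a, (map_smul ψ a v).symm⟩

end Johnson

/-! ### Bases adapted to a family of subspaces -/

namespace Module.Basis

variable {ι κ V : Type*} [AddCommGroup V] [Module ℂ V] [Fintype ι]

/-- The part of f on basis vectors outside S lies in T, and also in S as a difference of vectors of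
S. So it is zero, and a basis vector in T, being nonzero, is one of those outside S. -/
theorem repr_eq_zero_of_disjoint (B : Basis ι ℂ V) {S T : Submodule ℂ V} (hST : Disjoint S T)
    (hB : ∀ a, B a ∈ S ∨ B a ∈ T) {f : V} (hf : f ∈ S) {a : ι} (ha : B a ∈ T) :
    B.repr f a = 0 := by
  classical
  have haS : B a ∉ S := fun h => B.ne_zero a (Submodule.disjoint_def.mp hST _ h ha)
  set g := ∑ b with B b ∉ S, B.repr f b • B b with hg
  have hgT : g ∈ T := Submodule.sum_mem _ fun b hb =>
    T.smul_mem _ ((hB b).resolve_left (Finset.mem_filter.mp hb).2)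
  have hsum : ∑ b with B b ∈ S, B.repr f b • B b + g = f := by
    rw [hg, Finset.sum_filter_add_sum_filter_not, B.sum_repr]
  have hgS : g ∈ S := by
    rw [← eq_sub_iff_add_eq'] at hsum
    rw [hsum]
    exact S.sub_mem hf (Submodule.sum_mem _ fun b hb => S.smul_mem _ (Finset.mem_filter.mp hb).2)
  have hg0 := Submodule.disjoint_def.mp hST g hgS hgT
  exact linearIndependent_iff'.mp B.linearIndependent _ _ hg0 a
    (Finset.mem_filter.mpr ⟨Finset.mem_univ a, haS⟩)

/-- In a basis adapted to a family of subspaces each of which is separated from the others, a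
vector of one of the subspaces involves only basis vectors of that subspace. -/
theorem eq_of_repr_ne_zero (B : Basis ι ℂ V) (N : κ → Submodule ℂ V)
    (hN : ∀ s, ∃ T, Disjoint (N s) T ∧ ∀ t, N t = N s ∨ N t ≤ T) {t : ι → κ}
    (hB : ∀ a, B a ∈ N (t a)) {s : κ} {f : V} (hf : f ∈ N s) {a : ι} (ha : B.repr f a ≠ 0) :
    N (t a) = N s := by
  obtain ⟨T, hT, h⟩ := hN s
  refine (h (t a)).resolve_right fun hle => ha ?_
  refine B.repr_eq_zero_of_disjoint hT (fun b => ?_) hf (hle (hB a))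
  exact (h (t b)).imp (fun heq => heq.le (hB b)) fun hb => hb (hB b)

/-- By `hW` the basis vectors labelled W span W. The count depends on W alone, which makes the
blocks square when two bases are compared. -/
theorem card_fiber_eq_finrank (B : Basis ι ℂ V) {L : ι → Submodule ℂ V} (hL : ∀ a, B a ∈ L a)
    {W : Submodule ℂ V} (hW : ∀ f ∈ W, ∀ a, B.repr f a ≠ 0 → L a = W) :
    Nat.card {a // L a = W} = Module.finrank ℂ W := by
  classical
  have hspan : Submodule.span ℂ (Set.range fun a : {a // L a = W} => B a) = W := by
    refine le_antisymm (Submodule.span_le.mpr ?_) fun f hf => ?_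
    · rintro _ ⟨a, rfl⟩
      have h := hL a.1
      rw [a.2] at h
      exact h
    · rw [← B.sum_repr f]
      refine Submodule.sum_mem _ fun a _ => ?_
      by_cases ha : B.repr f a = 0
      · rw [ha, zero_smul]
        exact zero_mem _
      · exact Submodule.smul_mem _ _ (Submodule.subset_span ⟨⟨a, hW f hf a ha⟩, rfl⟩)
  have h := finrank_span_eq_card (R := ℂ) (b := fun a : {a // L a = W} => B a)
    (B.linearIndependent.comp _ Subtype.val_injective)
  rw [hspan] at h
  rw [h, Nat.card_eq_fintype_card]

end Module.Basis

/-! ### Orders that make the fibers of two labellings into matching blocks -/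

theorem Composition.exists_equiv_index_eq {N : ℕ} (s : Composition N) {X Λ : Type*} [Finite X]
    (g : Λ ≃ Fin s.length) (M : X → Λ)
    (h : ∀ t, Nat.card {x // M x = t} = s.blocksFun (g t)) :
    ∃ e : X ≃ Fin N, ∀ x, s.index (e x) = g (M x) := by
  let e₁ : (Σ t, {x // M x = t}) ≃ Σ i : Fin s.length, Fin (s.blocksFun i) :=
    Equiv.sigmaCongr g fun t => Finite.equivFinOfCardEq (h t)
  refine ⟨(Equiv.sigmaFiberEquiv M).symm.trans (e₁.trans s.blocksFinEquiv), fun x => ?_⟩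
  exact s.index_embedding _ _

theorem Composition.exists_of_card_fiber {ι Λ : Type*} [Finite ι] {N : ℕ} (hN : Nat.card ι = N)
    (L : ι → Λ) (hL : Function.Surjective L) :
    ∃ (s : Composition N) (g : Λ ≃ Fin s.length),
      ∀ t, Nat.card {b // L b = t} = s.blocksFun (g t) := by
  classical
  have : Finite Λ := Finite.of_surjective L hL
  have := Fintype.ofFinite Λ
  have := Fintype.ofFinite ι
  let d : Λ → ℕ := fun t => Nat.card {b // L b = t}
  let l : List Λ := Finset.univ.toList
  have hsum : (l.map d).sum = N := by
    rw [Finset.sum_map_toList, ← hN, ← Nat.card_congr (Equiv.sigmaFiberEquiv L), Nat.card_sigma]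
  let s : Composition N :=
    { blocks := l.map d
      blocks_pos := by
        intro m hm
        obtain ⟨t, -, rfl⟩ := List.mem_map.mp hm
        obtain ⟨b, hb⟩ := hL t
        have : Nonempty {b // L b = t} := ⟨⟨b, hb⟩⟩
        exact Nat.card_pos
      blocks_sum := hsum }
  let g₀ : Fin l.length ≃ Λ := List.Nodup.getEquivOfForallMemList l (Finset.nodup_toList _)
    fun t => Finset.mem_toList.mpr (Finset.mem_univ t)
  have hlen : l.length = s.length := (List.length_map d).symm
  refine ⟨s, g₀.symm.trans (finCongr hlen), fun t => ?_⟩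
  obtain ⟨i, rfl⟩ := g₀.surjective t
  rw [Equiv.trans_apply, Equiv.symm_apply_apply]
  exact (List.getElem_map d).symm

theorem Composition.exists_equiv_of_card_fiber_eq {ι ι' Λ : Type*} [Finite ι] [Finite ι'] {N : ℕ}
    (hN : Nat.card ι = N) (L : ι → Λ) (L' : ι' → Λ)
    (h : ∀ w, Nat.card {b // L b = w} = Nat.card {a // L' a = w}) :
    ∃ (e : ι ≃ Fin N) (e' : ι' ≃ Fin N) (s : Composition N),
      (∀ d ∈ s.blocks, ∃ w, d = Nat.card {b // L b = w}) ∧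
      ∀ a b, L' a = L b → s.index (e' a) = s.index (e b) := by
  have hmem : ∀ a, L' a ∈ Set.range L := fun a => by
    have h1 : Nonempty {x // L' x = L' a} := ⟨⟨a, rfl⟩⟩
    have h2 : 0 < Nat.card {b // L b = L' a} := (h (L' a)).symm ▸ Nat.card_pos
    obtain ⟨⟨b, hb⟩⟩ := (Nat.card_pos_iff.mp h2).1
    exact ⟨b, hb⟩
  -- Only labels that occur are kept, because the parts of a composition are positive.
  let M : ι → Set.range L := fun b => ⟨L b, b, rfl⟩
  let M' : ι' → Set.range L := fun a => ⟨L' a, hmem a⟩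
  have hM : ∀ t, Nat.card {b // M b = t} = Nat.card {b // L b = t.1} := fun t =>
    Nat.card_congr (Equiv.subtypeEquivRight fun b => Subtype.ext_iff)
  have hM' : ∀ t, Nat.card {a // M' a = t} = Nat.card {a // L' a = t.1} := fun t =>
    Nat.card_congr (Equiv.subtypeEquivRight fun b => Subtype.ext_iff)
  obtain ⟨s, g, hg⟩ := Composition.exists_of_card_fiber hN M (by
    rintro ⟨_, b, rfl⟩
    exact ⟨b, rfl⟩)
  obtain ⟨e, he⟩ := s.exists_equiv_index_eq g M hg
  obtain ⟨e', he'⟩ := s.exists_equiv_index_eq g M' fun t => by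
    rw [← hg, hM, hM', h]
  refine ⟨e, e', s, fun d hd => ?_, fun a b hab => ?_⟩
  · obtain ⟨i, hi, rfl⟩ := List.getElem_of_mem hd
    refine ⟨(g.symm ⟨i, hi⟩).1, ?_⟩
    rw [← hM, hg, Equiv.apply_symm_apply]
    rfl
  · rw [he, he']
    exact congrArg g (Subtype.ext hab)

/-! ### Independence of the components and the bound on the blocks -/

theorem isotypicComponent_mem_isotypicComponents {R M S : Type*} [Ring R] [AddCommGroup M]
    [Module R M] [AddCommGroup S] [Module R S] [IsSimpleModule R S]
    (h : isotypicComponent R M S ≠ ⊥) : isotypicComponent R M S ∈ isotypicComponents R M := by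
  have : ∃ m : Submodule R M, Nonempty (m ≃ₗ[R] S) := by
    by_contra! hne
    refine h ?_
    rw [isotypicComponent, sSup_eq_bot]
    rintro m ⟨e⟩
    exact ((hne m).false e).elim
  obtain ⟨m, ⟨e⟩⟩ := this
  exact ⟨m, IsSimpleModule.congr e, (e.isotypicComponent_eq).symm⟩

namespace Johnson

open Representation

/-- Distinct nonzero isotypic components are independent, so T can be the sum of the others. If `l`
does not occur, its component is zero and T can be everything. -/
theorem exists_disjoint_isotypic {n k j : ℕ} (l : Irrep (initialSym n j)) :
    ∃ T, Disjoint (isotypic k l) T ∧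
      ∀ l' : Irrep (initialSym n j), isotypic k l' = isotypic k l ∨ isotypic k l' ≤ T := by
  let R := ℂ[initialSym n j]
  let M := (funRepRestrict n k j).asModule
  have hsimple : ∀ l : Irrep (initialSym n j), IsSimpleModule R l.rep.asModule := fun l =>
    (irreducible_iff_isSimpleModule_asModule l.rep).mp l.irreducible
  by_cases h0 : isotypicComponent R M l.rep.asModule = ⊥
  · refine ⟨⊤, ?_, fun _ => Or.inr le_top⟩
    refine Submodule.disjoint_def.mpr fun f hf _ => ?_
    have hf' : f ∈ isotypicComponent R M l.rep.asModule := hf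
    rw [h0] at hf'
    exact hf'
  have hmem := isotypicComponent_mem_isotypicComponents h0
  refine ⟨(Subrepresentation.ofSubmodule' (sSup (isotypicComponents R M \
    {isotypicComponent R M l.rep.asModule}))).toSubmodule, ?_, fun l' => ?_⟩
  · refine Submodule.disjoint_def.mpr fun f hf hf' => ?_
    exact Submodule.disjoint_def.mp (sSupIndep_isotypicComponents R M hmem) f hf hf'
  · by_cases h : isotypicComponent R M l'.rep.asModule = isotypicComponent R M l.rep.asModule
    · left
      exact congrArg (fun N => (Subrepresentation.ofSubmodule' N).toSubmodule) h
    · right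
      by_cases h' : isotypicComponent R M l'.rep.asModule = ⊥
      · intro f hf
        have hf' : f ∈ isotypicComponent R M l'.rep.asModule := hf
        rw [h'] at hf'
        have hf0 : f = 0 := hf'
        rw [hf0]
        exact zero_mem _
      · exact le_sSup (a := isotypicComponent R M l'.rep.asModule)
          ⟨isotypicComponent_mem_isotypicComponents h', h⟩

theorem disjoint_letterSpace {n : ℕ} (k : ℕ) (m : Fin n) {c c' : Letter} (h : c ≠ c') :
    Disjoint (letterSpace k m c) (letterSpace k m c') := by
  refine Submodule.disjoint_def.mpr fun f hf hf' => funext fun x => ?_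
  by_cases hx : letterAt x m = c
  · exact apply_eq_zero_of_mem_letterSpace hf' (hx ▸ h)
  · exact apply_eq_zero_of_mem_letterSpace hf hx

theorem exists_disjoint_letterSpace {n : ℕ} (k : ℕ) (m : Fin n) (c : Letter) :
    ∃ T, Disjoint (letterSpace k m c) T ∧
      ∀ c', letterSpace k m c' = letterSpace k m c ∨ letterSpace k m c' ≤ T := by
  cases c
  · refine ⟨letterSpace k m Letter.two, disjoint_letterSpace k m nofun, fun c' => ?_⟩
    cases c'
    exacts [Or.inl rfl, Or.inr le_rfl]
  · refine ⟨letterSpace k m Letter.one, disjoint_letterSpace k m nofun, fun c' => ?_⟩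
    cases c'
    exacts [Or.inr le_rfl, Or.inl rfl]

/-- The chain without its last vertex. -/
def BranchChain.init {n i : ℕ} (l : BranchChain n (i + 1)) : BranchChain n i where
  irr j := l.irr j.castSucc
  branches j h := l.branches j (h.trans (Nat.lt_succ_self i))

/-- The word without its first letter. -/
def TailWord.tail {n i : ℕ} (c : TailWord n i) : TailWord n (i + 1) :=
  fun m => c ⟨m.1, (Nat.le_succ i).trans m.2⟩

/-- The subspace `F_{l₁ … l_i}^{c_{i+2} … c_n}`, with no condition at the place `i + 1`. -/
noncomputable def partialSpace {n i : ℕ} (k : ℕ) (p : BranchChain n i × TailWord n (i + 1)) :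
    Submodule ℂ (FunSpace n k) :=
  (⨅ j : Fin i, isotypic k (p.1.irr j)) ⊓ tailSpace k p.2

theorem mem_partialSpace {n k i : ℕ} {p : BranchChain n i × TailWord n (i + 1)}
    {f : FunSpace n k} : f ∈ partialSpace k p ↔
      (∀ j, f ∈ isotypic k (p.1.irr j)) ∧ ∀ m, f ∈ letterSpace k m.1 (p.2 m) := by
  simp only [partialSpace, tailSpace, Submodule.mem_inf, Submodule.mem_iInf]

theorem mem_gtSpace {n k i : ℕ} {l : BranchChain n i} {c : TailWord n i} {f : FunSpace n k} :
    f ∈ gtSpace k l c ↔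
      (∀ j, f ∈ isotypic k (l.irr j)) ∧ ∀ m, f ∈ letterSpace k m.1 (c m) := by
  simp only [gtSpace, tailSpace, Submodule.mem_inf, Submodule.mem_iInf]

theorem gtSpace_le_partialSpace_init {n k i : ℕ} (l : BranchChain n (i + 1))
    (c : TailWord n (i + 1)) : gtSpace k l c ≤ partialSpace k (l.init, c) := fun _ hf =>
  mem_partialSpace.mpr ⟨fun j => (mem_gtSpace.mp hf).1 j.castSucc, (mem_gtSpace.mp hf).2⟩

theorem gtSpace_le_partialSpace_tail {n k i : ℕ} (l : BranchChain n i) (c : TailWord n i) :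
    gtSpace k l c ≤ partialSpace k (l, c.tail) := by
  intro f hf
  rw [mem_gtSpace] at hf
  rw [mem_partialSpace]
  exact ⟨hf.1, fun m => hf.2 ⟨m.1, (Nat.le_succ i).trans m.2⟩⟩

/-- The isotypic and letter conditions are compared one at a time, so independence is needed only
within each family, not for the intersections. -/
theorem partialSpace_eq_of_repr_ne_zero {n k i : ℕ} {ι : Type*} [Fintype ι]
    (B : Module.Basis ι ℂ (FunSpace n k)) {t : ι → BranchChain n i × TailWord n (i + 1)}
    (hB : ∀ a, B a ∈ partialSpace k (t a)) {s : BranchChain n i × TailWord n (i + 1)}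
    {f : FunSpace n k} (hf : f ∈ partialSpace k s) {a : ι} (ha : B.repr f a ≠ 0) :
    partialSpace k (t a) = partialSpace k s := by
  have h₁ : ∀ j, isotypic k ((t a).1.irr j) = isotypic k (s.1.irr j) := fun j =>
    B.eq_of_repr_ne_zero (isotypic k) exists_disjoint_isotypic
      (t := fun a => (t a).1.irr j) (fun a => (mem_partialSpace.mp (hB a)).1 j)
      ((mem_partialSpace.mp hf).1 j) ha
  have h₂ : ∀ m, letterSpace k m.1 ((t a).2 m) = letterSpace k m.1 (s.2 m) := fun m =>
    B.eq_of_repr_ne_zero (letterSpace k m.1) (exists_disjoint_letterSpace k m.1)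
      (t := fun a => (t a).2 m) (fun a => (mem_partialSpace.mp (hB a)).2 m)
      ((mem_partialSpace.mp hf).2 m) ha
  unfold partialSpace tailSpace
  simp only [h₁, h₂]

/-- Fixing the letter at place i + 1 turns the partial space into a Gelfand-Tsetlin space, which is
at most a line. There are only two letters, so three basis vectors would put two on one line. -/
theorem card_fiber_partialSpace_le_two {n k i : ℕ} (hi : i < n) {ι : Type*} [Finite ι]
    (B : Module.Basis ι ℂ (FunSpace n k)) {l : ι → BranchChain n i} {c : ι → TailWord n i}
    (hB : ∀ a, B a ∈ gtSpace k (l a) (c a)) (W : Submodule ℂ (FunSpace n k)) :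
    Nat.card {a // partialSpace k (l a, (c a).tail) = W} ≤ 2 := by
  classical
  have := Fintype.ofFinite ι
  by_contra! hlt
  let f : {a // partialSpace k (l a, (c a).tail) = W} → Bool := fun a =>
    match c a ⟨⟨i, hi⟩, le_rfl⟩ with
    | Letter.one => true
    | Letter.two => false
  obtain ⟨⟨a, ha⟩, ⟨b, hb⟩, hne, hab⟩ := Fintype.exists_ne_map_eq_of_card_lt f (by
    rwa [Fintype.card_bool, ← Nat.card_eq_fintype_card])
  have hne' : a ≠ b := fun h => hne (Subtype.ext h)
  have hc : c a ⟨⟨i, hi⟩, le_rfl⟩ = c b ⟨⟨i, hi⟩, le_rfl⟩ := by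
    simp only [f] at hab
    cases ha' : c a ⟨⟨i, hi⟩, le_rfl⟩ <;> cases hb' : c b ⟨⟨i, hi⟩, le_rfl⟩ <;>
      simp_all
  have hmem : B b ∈ partialSpace k (l a, (c a).tail) := by
    rw [ha, ← hb]
    exact gtSpace_le_partialSpace_tail _ _ (hB b)
  rw [mem_partialSpace] at hmem
  have hBb : B b ∈ gtSpace k (l a) (c a) := by
    refine mem_gtSpace.mpr ⟨hmem.1, fun m => ?_⟩
    by_cases hm : i + 1 ≤ m.1.val
    · exact hmem.2 ⟨m.1, hm⟩
    · have hm' : m = ⟨⟨i, hi⟩, le_rfl⟩ := by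
        have := m.2
        exact Subtype.ext (Fin.ext (show m.1.val = i by omega))
      rw [hm', hc]
      exact (mem_gtSpace.mp (hB b)).2 _
  obtain ⟨v, hv⟩ := exists_gtSpace_le_span (k := k) (l a) (c a)
  obtain ⟨x, hx⟩ := Submodule.mem_span_singleton.mp (hv (hB a))
  obtain ⟨y, hy⟩ := Submodule.mem_span_singleton.mp (hv hBb)
  -- With B a = xv and B b = yv, the coordinate at `a` forces y = 0, hence B b = 0.
  have h : y • B a = x • B b := by rw [← hx, ← hy, smul_smul, smul_smul, mul_comm]
  have h' := congrArg (fun f => B.repr f a) h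
  simp only [map_smul, Module.Basis.repr_self, Finsupp.smul_apply, Finsupp.single_eq_same,
    smul_eq_mul, mul_one, Finsupp.single_eq_of_ne hne', mul_zero] at h'
  exact B.ne_zero b (by rw [← hy, h', zero_smul])

end Johnson

/-! ### The block-diagonal form -/

theorem mainTheorem2 {n k : ℕ} (hk : k ≤ n) {i : ℕ} (hi : 1 ≤ i) (hin : i ≤ n)
    {ι ι' : Type*}
    (B : Module.Basis ι ℂ (Johnson.FunSpace n k))
    (B' : Module.Basis ι' ℂ (Johnson.FunSpace n k))
    (hB : Johnson.IsIntermediateBasis i B)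
    (hB' : Johnson.IsIntermediateBasis (i - 1) B') :
    (∃ (e : ι ≃ Fin (n.choose k)) (e' : ι' ≃ Fin (n.choose k)) (s : Composition (n.choose k)),
      (∀ d ∈ s.blocks, d ≤ 2) ∧
      Johnson.IsBlockDiagonal s (Matrix.reindex e' e (Johnson.changeOfBasis B B'))) ∧
    (∀ b : ι, {a : ι' | Johnson.changeOfBasis B B' a b ≠ 0}.encard ≤ 2) := by
  obtain ⟨j, rfl⟩ : ∃ j, i = j + 1 := ⟨i - 1, by omega⟩
  rw [Nat.add_sub_cancel] at hB'
  have : Finite ι := Module.Finite.finite_basis B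
  have : Finite ι' := Module.Finite.finite_basis B'
  have := Fintype.ofFinite ι
  have := Fintype.ofFinite ι'
  have hN : Nat.card ι = n.choose k := by
    rw [← Module.finrank_eq_nat_card_basis B, Module.finrank_fintype_fun_eq_card,
      Fintype.card_finset_len, Fintype.card_fin]
  choose l c _ hl using hB
  choose l' c' _ hl' using hB'
  have hBp : ∀ b, B b ∈ Johnson.partialSpace k ((l b).init, c b) := fun b =>
    Johnson.gtSpace_le_partialSpace_init _ _ (hl b)
  have hBp' : ∀ a, B' a ∈ Johnson.partialSpace k (l' a, (c' a).tail) := fun a =>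
    Johnson.gtSpace_le_partialSpace_tail _ _ (hl' a)
  -- The labels are the subspaces themselves, since chains of isomorphic but unequal representations
  -- define the same subspace.
  set L : ι → Submodule ℂ (Johnson.FunSpace n k) := fun b =>
    Johnson.partialSpace k ((l b).init, c b) with hLdef
  set L' : ι' → Submodule ℂ (Johnson.FunSpace n k) := fun a =>
    Johnson.partialSpace k (l' a, (c' a).tail) with hLdef'
  have htwo : ∀ w, Nat.card {a // L' a = w} ≤ 2 :=
    Johnson.card_fiber_partialSpace_le_two (by omega) B' hl'
  have hfiber : ∀ p : Johnson.BranchChain n j × Johnson.TailWord n (j + 1),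
      Nat.card {b // L b = Johnson.partialSpace k p} =
        Nat.card {a // L' a = Johnson.partialSpace k p} := fun p => by
    rw [B.card_fiber_eq_finrank hBp fun f hf a ha =>
        Johnson.partialSpace_eq_of_repr_ne_zero B hBp hf ha,
      B'.card_fiber_eq_finrank hBp' fun f hf a ha =>
        Johnson.partialSpace_eq_of_repr_ne_zero B' hBp' hf ha]
  have hcard : ∀ w, Nat.card {b // L b = w} = Nat.card {a // L' a = w} := fun w => by
    by_cases hw : ∃ p : Johnson.BranchChain n j × Johnson.TailWord n (j + 1), w = Johnson.partialSpace k p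
    · obtain ⟨p, rfl⟩ := hw
      exact hfiber p
    -- A subspace that is not a partial space labels no element of either basis.
    · have : IsEmpty {b // L b = w} := ⟨fun b => hw ⟨_, b.2.symm⟩⟩
      have : IsEmpty {a // L' a = w} := ⟨fun a => hw ⟨_, a.2.symm⟩⟩
      rw [Nat.card_of_isEmpty, Nat.card_of_isEmpty]
  have hentry : ∀ a b, Johnson.changeOfBasis B B' a b ≠ 0 → L' a = L b := fun a b h =>
    Johnson.partialSpace_eq_of_repr_ne_zero B' hBp' (hBp b) h
  refine ⟨?_, fun b => ?_⟩
  · obtain ⟨e, e', s, hs, hidx⟩ := Composition.exists_equiv_of_card_fiber_eq hN L L' hcard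
    refine ⟨e, e', s, fun d hd => ?_, fun x y hxy => ?_⟩
    · obtain ⟨w, rfl⟩ := hs d hd
      exact (hcard w).trans_le (htwo w)
    · rw [Matrix.reindex_apply, Matrix.submatrix_apply]
      by_contra h
      have h' := hidx _ _ (hentry _ _ h)
      rw [Equiv.apply_symm_apply, Equiv.apply_symm_apply] at h'
      exact hxy h'
  · calc {a : ι' | Johnson.changeOfBasis B B' a b ≠ 0}.encard
        ≤ {a : ι' | L' a = L b}.encard := Set.encard_le_encard fun a ha => hentry a b ha
      _ = Nat.card {a // L' a = L b} := by
        rw [← (Set.toFinite _).cast_ncard_eq, ← Nat.card_coe_set_eq]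
        rfl
      _ ≤ 2 := by exact_mod_cast htwo (L b)
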